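/- Let $K$ be a number field of degree $k=[K:\mathbb{Q}]$ with ring of integers $\mathfrak{o}$, and let $d\ge 2$ be an integer. For an integral basis $\mathbb{E}=\{e_1,\dots,e_k\}$ of $\mathfrak{o}$ and $H\in\mathbb{N}$ put $$O(H,\mathbb{E})=\Big\{\sum_{j=1}^k a_je_j \;:\; a_j\in\mathbb{Z},\ -H\le a_j<H\Big\}.$$ For $n\ge 1$, the density of a set $T\subseteq\mathfrak{o}^{n}$ with respect to $\mathbb{E}$ is $\rho_{\mathbb{E}}(T)=\lim_{H\to\infty}\frac{|T\cap O(H,\mathbb{E})^{n}|}{(2H)^{nk}}$, if this limit exists. For a non-zero prime ideal $\mathfrak{p}$ of $\mathfrak{o}$, a polynomial $a_0+a_1x+\dots+a_dx^d$ of degree $d$ over $\mathfrak{o}$, identified with $(a_0,\dots,a_d)\in\mathfrak{o}^{d+1}$, is called $\mathfrak{p}$-Eisenstein if $a_d\notin\mathfrak{p}$, $a_0\notin\mathfrak{p}^2$ and $a_i\in\mathfrak{p}$ for all $0\le i\le d-1$. Let $\Gamma^d\subseteq\mathfrak{o}^{d+1}$ be the set of Eisenstein polynomials of degree $d$, that is,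 of those that are $\mathfrak{p}$-Eisenstein for some non-zero prime ideal $\mathfrak{p}$. Then for every integral basis $\mathbb{E}$ of $\mathfrak{o}$ the density $\rho_{\mathbb{E}}(\Gamma^d)$ exists, it does not depend on $\mathbb{E}$, and $$\rho_{\mathbb{E}}(\Gamma^d)=1-\prod_{\mathfrak{p}}\left(1-\frac{(N(\mathfrak{p})-1)^2}{N(\mathfrak{p})^{d+2}}\right),$$ where the (convergent) product runs over all non-zero prime ideals $\mathfrak{p}$ of $\mathfrak{o}$ and $N(\mathfrak{p})=|\mathfrak{o}/\mathfrak{p}|$. -/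

import Mathlib

open scoped NumberField

namespace EisensteinDensity

/-- An integral basis of the ring of integers of `K`, indexed by `1, …, k` with `k = [K : ℚ]`. -/
abbrev IntegralBasis (K : Type*) [Field K] [NumberField K] :=
  Module.Basis (Fin (Module.finrank ℚ K)) ℤ (𝓞 K)

/-- The box `O(H, 𝔼)` of all `∑ⱼ aⱼ eⱼ` whose integer coordinates satisfy `-H ≤ aⱼ < H`. -/
def box {K : Type*} [Field K] [NumberField K] (E : IntegralBasis K) (H : ℕ) : Set (𝓞 K) :=
  {x | ∀ j, E.repr x j ∈ Set.Ico (-(H : ℤ)) (H : ℤ)}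

/-- The cartesian power `O(H, 𝔼)ⁿ`. -/
def boxPow {K : Type*} [Field K] [NumberField K] (E : IntegralBasis K) (n H : ℕ) :
    Set (Fin n → 𝓞 K) :=
  {a | ∀ i, a i ∈ box E H}

/-- The boxes are finite, so that `Set.ncard` below is the true cardinality. -/
theorem boxPow_finite {K : Type*} [Field K] [NumberField K] (E : IntegralBasis K) (n H : ℕ) :
    (boxPow E n H).Finite := by
  have hbox : (box E H).Finite := by
    have h : (Set.univ.pi fun _ : Fin (Module.finrank ℚ K) =>
        Set.Ico (-(H : ℤ)) (H : ℤ)).Finite := Set.Finite.pi fun _ => Set.finite_Ico _ _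
    refine (h.preimage (f := E.equivFun) E.equivFun.injective.injOn).subset ?_
    intro x hx j _
    simpa [Module.Basis.equivFun_apply] using hx j
  refine (Set.Finite.pi (ι := Fin n) fun _ => hbox).subset ?_
  intro a ha i _
  exact ha i

/-- `T ⊆ 𝔬ⁿ` has density `r` with respect to the integral basis `𝔼`:
`|T ∩ O(H, 𝔼)ⁿ| / (2H)^(nk) → r` as `H → ∞`. -/
def HasDensityWrt {K : Type*} [Field K] [NumberField K] {n : ℕ} (E : IntegralBasis K)
    (T : Set (Fin n → 𝓞 K)) (r : ℝ) : Prop :=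
  Filter.Tendsto
    (fun H : ℕ => ((T ∩ boxPow E n H).ncard : ℝ) / (2 * (H : ℝ)) ^ (n * Module.finrank ℚ K))
    Filter.atTop (nhds r)

/-- `ρ(T) = r`: the density of `T ⊆ 𝔬ⁿ` exists with respect to every integral basis,
and is always equal to `r`. -/
def HasDensity {K : Type*} [Field K] [NumberField K] {n : ℕ}
    (T : Set (Fin n → 𝓞 K)) (r : ℝ) : Prop :=
  ∀ E : IntegralBasis K, HasDensityWrt E T r

/-- The polynomial `a₀ + a₁ x + ⋯ + a_d x^d` over `𝔬`, represented by its tuple of coefficients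
`(a₀, …, a_d)`, is `𝔭`-Eisenstein of degree `d`. -/
def IsEisensteinAt {K : Type*} [Field K] [NumberField K] {d : ℕ} (𝔭 : Ideal (𝓞 K))
    (a : Fin (d + 1) → 𝓞 K) : Prop :=
  a (Fin.last d) ∉ 𝔭 ∧ a 0 ∉ 𝔭 ^ 2 ∧ ∀ i : Fin d, a i.castSucc ∈ 𝔭

/-- The set `Γ^d` of Eisenstein polynomials of degree `d` over `𝔬`, as coefficient tuples: those
that are `𝔭`-Eisenstein for some non-zero prime ideal `𝔭`. -/
def eisensteinSet (K : Type*) [Field K] [NumberField K] (d : ℕ) : Set (Fin (d + 1) → 𝓞 K) :=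
  {a | ∃ 𝔭 : Ideal (𝓞 K), 𝔭.IsPrime ∧ 𝔭 ≠ ⊥ ∧ IsEisensteinAt 𝔭 a}

end EisensteinDensity

/-!
For finitely many primes `𝔭`, being `𝔭`-Eisenstein is a condition modulo `𝔭²`; these ideals are
pairwise coprime, and the boxes equidistribute in every finite quotient; so the densities of the
complementary conditions multiply. It remains to see that the Eisenstein polynomials outside a
finite set `S` of primes have small upper density. Their constant coefficient is non-zero and lies,
with the linear one, in a prime `𝔭 ∉ S` above some rational prime `p`. If `p ≤ 2H`, then `𝔭`
contains at most `2 (2H)ᵏ / p` points of the box, and `∑ 1 / p²` converges. If `p > 2H`, then `𝔭`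
contains at most `(2H)ᵏ⁻¹` points of the box, while comparing norms shows that a non-zero point of
the box lies in at most `k` such `𝔭`; these pairs have proportion at most `k / (2H)`.
-/

namespace EisensteinDensity

open Filter IsDedekindDomain Topology

theorem ncard_univ_pi {ι : Type*} [Fintype ι] {α : ι → Type*} (s : ∀ i, Set (α i)) :
    (Set.univ.pi s).ncard = ∏ i, (s i).ncard := by
  simp only [Set.ncard, Set.encard_pi_eq_prod_encard]
  exact map_prod ENat.toNatHom _ _

theorem ncard_Ico_neg (H : ℕ) : (Set.Ico (-(H : ℤ)) H).ncard = 2 * H := by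
  rw [Set.ncard_eq_toFinset_card', Set.toFinset_Ico, Int.card_Ico]
  lia

section Boxes

variable {K : Type*} [Field K] [NumberField K] (E : IntegralBasis K)

theorem ncard_box (H : ℕ) : (box E H).ncard = (2 * H) ^ Module.finrank ℚ K := by
  have hbox : box E H = E.equivFun ⁻¹' Set.univ.pi fun _ => Set.Ico (-(H : ℤ)) H := by
    ext x
    simp [box]
  rw [hbox, Set.ncard_preimage_of_injective_subset_range E.equivFun.injective
    (by simp [E.equivFun.surjective.range_eq]), ncard_univ_pi]
  simp [ncard_Ico_neg]

theorem box_finite (H : ℕ) : (box E H).Finite :=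
  ((boxPow_finite E 1 H).image fun a => a 0).subset fun x hx => ⟨fun _ => x, fun _ => hx, rfl⟩

theorem ncard_boxPow (n H : ℕ) :
    (boxPow E n H).ncard = (2 * H) ^ (n * Module.finrank ℚ K) := by
  have hpow : boxPow E n H = Set.univ.pi fun _ => box E H := by
    ext a
    simp [boxPow]
  rw [hpow, ncard_univ_pi]
  simp [ncard_box, ← pow_mul, mul_comm]

variable {n : ℕ}

theorem boxPow_mono : Monotone (boxPow E n) := by
  intro H H' hH a ha i j
  have haij := ha i j
  rw [Set.mem_Ico] at haij ⊢
  lia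

variable {E} in
theorem add_mem_boxPow {H c : ℕ} {a w : Fin n → 𝓞 K} (ha : a ∈ boxPow E n H)
    (hw : w ∈ boxPow E n c) : a + w ∈ boxPow E n (H + c) := by
  intro i j
  have haij := ha i j
  have hwij := hw i j
  simp only [Set.mem_Ico, Pi.add_apply, map_add, Finsupp.add_apply] at haij hwij ⊢
  lia

theorem exists_mem_boxPow (w : Fin n → 𝓞 K) : ∃ c, w ∈ boxPow E n c := by
  have hcoord : ∀ᶠ c : ℕ in atTop, w ∈ boxPow E n c :=
    eventually_all.2 fun i => eventually_all.2 fun j => by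
      filter_upwards [eventually_gt_atTop (E.repr (w i) j).natAbs] with c hc
      rw [Set.mem_Ico]
      lia
  exact hcoord.exists

/-- The proportion `|T ∩ O(H, 𝔼)ⁿ| / (2H)^(nk)` whose limit is the density of `T`; for `H = 0` it
may be the junk value of a division by `0`. -/
noncomputable def boxRatio (T : Set (Fin n → 𝓞 K)) (H : ℕ) : ℝ :=
  (T ∩ boxPow E n H).ncard / (2 * (H : ℝ)) ^ (n * Module.finrank ℚ K)

theorem boxRatio_mono {T T' : Set (Fin n → 𝓞 K)} (hT : T ⊆ T') (H : ℕ) :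
    boxRatio E T H ≤ boxRatio E T' H := by
  unfold boxRatio
  gcongr
  exact (boxPow_finite E n H).inter_of_right _

theorem boxRatio_le_add_sdiff (T T' : Set (Fin n → 𝓞 K)) (H : ℕ) :
    boxRatio E T H ≤ boxRatio E T' H + boxRatio E (T \ T') H := by
  unfold boxRatio
  rw [← add_div]
  gcongr
  norm_cast
  refine (Set.ncard_le_ncard ?_ (((boxPow_finite E n H).inter_of_right _).union
    ((boxPow_finite E n H).inter_of_right _))).trans (Set.ncard_union_le _ _)
  rintro a ⟨haT, ha⟩
  by_cases haT' : a ∈ T'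
  · exact Or.inl ⟨haT', ha⟩
  · exact Or.inr ⟨⟨haT, haT'⟩, ha⟩

variable {E} in
theorem hasDensityWrt_iff {T : Set (Fin n → 𝓞 K)} {r : ℝ} :
    HasDensityWrt E T r ↔ Tendsto (boxRatio E T) atTop (𝓝 r) :=
  Iff.rfl

theorem boxRatio_univ {H : ℕ} (hH : H ≠ 0) :
    boxRatio E (Set.univ : Set (Fin n → 𝓞 K)) H = 1 := by
  rw [boxRatio, Set.univ_inter, ncard_boxPow]
  push_cast
  exact div_self (by positivity)

theorem boxRatio_compl {H : ℕ} (hH : H ≠ 0) (T : Set (Fin n → 𝓞 K)) :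
    boxRatio E Tᶜ H = 1 - boxRatio E T H := by
  have hcard := Set.ncard_inter_add_ncard_sdiff_eq_ncard (boxPow E n H) T (boxPow_finite E n H)
  rw [Set.sdiff_eq, Set.inter_comm, Set.inter_comm _ Tᶜ] at hcard
  rw [eq_sub_iff_add_eq', ← boxRatio_univ E (n := n) hH]
  simp only [boxRatio, Set.univ_inter, ← add_div]
  exact_mod_cast congrArg (fun N : ℕ => (N : ℝ) / (2 * H) ^ (n * Module.finrank ℚ K)) hcard

theorem boxRatio_preimage_finset {A : Type*} (φ : (Fin n → 𝓞 K) → A) (B : Finset A) (H : ℕ) :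
    boxRatio E (φ ⁻¹' B) H = ∑ b ∈ B, boxRatio E (φ ⁻¹' {b}) H := by
  have hunion : φ ⁻¹' B ∩ boxPow E n H =
      ⋃ b ∈ (B : Set A), φ ⁻¹' {b} ∩ boxPow E n H := by
    ext a
    simp
  have hcard : (φ ⁻¹' B ∩ boxPow E n H).ncard = ∑ b ∈ B, (φ ⁻¹' {b} ∩ boxPow E n H).ncard := by
    rw [hunion, B.finite_toSet.ncard_biUnion
      (fun _ _ => (boxPow_finite E n H).inter_of_right _), finsum_mem_coe_finset]
    exact fun b _ b' _ hb => ((Set.disjoint_singleton.2 hb).preimage φ).mono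
      Set.inter_subset_left Set.inter_subset_left
  simp only [boxRatio, ← Finset.sum_div, hcard, Nat.cast_sum]

variable {E} in
theorem HasDensityWrt.compl {T : Set (Fin n → 𝓞 K)} {r : ℝ} (hT : HasDensityWrt E T r) :
    HasDensityWrt E Tᶜ (1 - r) := by
  refine hasDensityWrt_iff.2 (((hasDensityWrt_iff.1 hT).const_sub 1).congr' ?_)
  filter_upwards [eventually_ne_atTop 0] with H hH
  rw [boxRatio_compl E hH]

variable {E} in
theorem hasDensityWrt_of_tendsto {ι : Type*} {l : Filter ι} [l.NeBot]
    {T : Set (Fin n → 𝓞 K)} {T' : ι → Set (Fin n → 𝓞 K)} {r' δ : ι → ℝ} {r : ℝ} {η : ℕ → ℝ}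
    (hsub : ∀ i, T' i ⊆ T) (hdens : ∀ i, HasDensityWrt E (T' i) (r' i))
    (hr : Tendsto r' l (𝓝 r)) (hδ : Tendsto δ l (𝓝 0)) (hη : Tendsto η atTop (𝓝 0))
    (hdiff : ∀ i, ∀ᶠ H in atTop, boxRatio E (T \ T' i) H ≤ δ i + η H) :
    HasDensityWrt E T r := by
  refine tendsto_order.2 ⟨fun s hs => ?_, fun s hs => ?_⟩
  · obtain ⟨i, hi⟩ := (hr.eventually_const_lt hs).exists
    filter_upwards [(hdens i).eventually_const_lt hi] with H hH
    exact hH.trans_le (boxRatio_mono E (hsub i) H)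
  · have hrδ : Tendsto (fun i => r' i + δ i) l (𝓝 r) := by simpa using hr.add hδ
    obtain ⟨i, hi⟩ := (hrδ.eventually_lt_const hs).exists
    have hlim : Tendsto (fun H => boxRatio E (T' i) H + (δ i + η H)) atTop (𝓝 (r' i + δ i)) := by
      simpa using (hasDensityWrt_iff.1 (hdens i)).add (hη.const_add (δ i))
    filter_upwards [hlim.eventually_lt_const hi, hdiff i] with H hH hHdiff
    calc boxRatio E T H ≤ boxRatio E (T' i) H + boxRatio E (T \ T' i) H :=
          boxRatio_le_add_sdiff E T (T' i) H
      _ ≤ boxRatio E (T' i) H + (δ i + η H) := by gcongr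
      _ < s := hH

theorem boxRatio_preimage_add_le {c H : ℕ} {w : Fin n → 𝓞 K} (hw : w ∈ boxPow E n c)
    (hH : H ≠ 0) (T : Set (Fin n → 𝓞 K)) :
    boxRatio E ((· + w) ⁻¹' T) H ≤ boxRatio E T H +
      ((1 + c / (H : ℝ)) ^ (n * Module.finrank ℚ K) - 1) := by
  have hshift : ((· + w) ⁻¹' T ∩ boxPow E n H).ncard ≤ (T ∩ boxPow E n (H + c)).ncard :=
    Set.ncard_le_ncard_of_injOn (· + w) (fun a ha => ⟨ha.1, add_mem_boxPow ha.2 hw⟩)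
      (add_left_injective w).injOn ((boxPow_finite E n _).inter_of_right _)
  have hcover : T ∩ boxPow E n (H + c) ⊆
      T ∩ boxPow E n H ∪ boxPow E n (H + c) \ boxPow E n H := fun a ⟨haT, ha⟩ =>
    (em (a ∈ boxPow E n H)).imp (⟨haT, ·⟩) (⟨ha, ·⟩)
  have hcount : ((· + w) ⁻¹' T ∩ boxPow E n H).ncard + (boxPow E n H).ncard ≤
      (T ∩ boxPow E n H).ncard + (boxPow E n (H + c)).ncard := by
    have h₁ := (Set.ncard_le_ncard hcover (((boxPow_finite E n H).inter_of_right _).union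
      ((boxPow_finite E n _).sdiff))).trans (Set.ncard_union_le _ _)
    have h₂ := Set.ncard_sdiff_add_ncard_of_subset (boxPow_mono E (n := n) (Nat.le_add_right H c))
      (boxPow_finite E n _)
    lia
  have hcount' : (((· + w) ⁻¹' T ∩ boxPow E n H).ncard : ℝ) +
      (2 * (H : ℝ)) ^ (n * Module.finrank ℚ K) ≤ (T ∩ boxPow E n H).ncard +
        (1 + c / (H : ℝ)) ^ (n * Module.finrank ℚ K) *
          (2 * (H : ℝ)) ^ (n * Module.finrank ℚ K) := by
    rw [← mul_pow, show (1 + c / (H : ℝ)) * (2 * H) = 2 * (H + c) by field_simp]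
    simp only [ncard_boxPow] at hcount
    exact_mod_cast hcount
  unfold boxRatio
  rw [div_add' _ _ _ (by positivity)]
  gcongr
  linarith

theorem tendsto_boxRatio_preimage_add_sub (T : Set (Fin n → 𝓞 K)) (w : Fin n → 𝓞 K) :
    Tendsto (fun H => boxRatio E ((· + w) ⁻¹' T) H - boxRatio E T H) atTop (𝓝 0) := by
  obtain ⟨c, hc⟩ := exists_mem_boxPow E w
  obtain ⟨c', hc'⟩ := exists_mem_boxPow E (-w)
  have hgrowth (b : ℕ) : Tendsto
      (fun H : ℕ => (1 + b / (H : ℝ)) ^ (n * Module.finrank ℚ K) - 1) atTop (𝓝 0) := by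
    simpa using (((tendsto_const_div_atTop_nhds_zero_nat (b : ℝ)).const_add 1).pow
      (n * Module.finrank ℚ K)).sub_const 1
  have hlower := (hgrowth c').neg
  rw [neg_zero] at hlower
  refine tendsto_of_tendsto_of_tendsto_of_le_of_le' hlower (hgrowth c) ?_ ?_
  · filter_upwards [eventually_ne_atTop 0] with H hH
    have hback := boxRatio_preimage_add_le E hc' hH ((· + w) ⁻¹' T)
    have hT : (· + -w) ⁻¹' ((· + w) ⁻¹' T) = T := by
      ext a
      simp
    rw [hT] at hback
    linarith
  · filter_upwards [eventually_ne_atTop 0] with H hH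
    linarith [boxRatio_preimage_add_le E hc hH T]

section FiniteQuotient

variable {A : Type*} [AddGroup A] [Finite A] {φ : (Fin n → 𝓞 K) →+ A}

theorem hasDensityWrt_preimage_singleton (hφ : Function.Surjective φ) (b : A) :
    HasDensityWrt E (φ ⁻¹' {b}) (1 / Nat.card A) := by
  have := Fintype.ofFinite A
  let f (b : A) := boxRatio E (φ ⁻¹' {b})
  have hfiber (b' : A) : Tendsto (fun H => f b' H - f b H) atTop (𝓝 0) := by
    obtain ⟨w, hw⟩ := hφ (-b' + b)
    have htranslate : (· + w) ⁻¹' (φ ⁻¹' {b}) = φ ⁻¹' {b'} := by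
      ext a
      simp [hw, ← add_assoc, add_neg_eq_zero]
    simpa only [f, htranslate] using tendsto_boxRatio_preimage_add_sub E (φ ⁻¹' {b}) w
  have hsum : Tendsto (fun H => ∑ b', (f b' H - f b H)) atTop (𝓝 0) := by
    simpa using tendsto_finsetSum Finset.univ fun b' _ => hfiber b'
  have hlim := (hsum.const_sub 1).div_const (Nat.card A : ℝ)
  rw [sub_zero] at hlim
  refine hlim.congr' ?_
  filter_upwards [eventually_ne_atTop 0] with H hH
  have htotal : ∑ b', f b' H = 1 := by
    rw [← boxRatio_preimage_finset, Finset.coe_univ, Set.preimage_univ, boxRatio_univ E hH]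
  rw [Finset.sum_sub_distrib, htotal, sub_sub_cancel, Finset.sum_const, Finset.card_univ,
    nsmul_eq_mul, ← Nat.card_eq_fintype_card]
  exact mul_div_cancel_left₀ _ (Nat.cast_ne_zero.2 Nat.card_pos.ne')

theorem hasDensityWrt_preimage (hφ : Function.Surjective φ) (B : Set A) :
    HasDensityWrt E (φ ⁻¹' B) (B.ncard / Nat.card A) := by
  have hsum := tendsto_finsetSum B.toFinite.toFinset fun b _ =>
    hasDensityWrt_preimage_singleton E hφ b
  rw [Finset.sum_const, nsmul_eq_mul, mul_one_div, ← Set.ncard_eq_toFinset_card] at hsum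
  refine hasDensityWrt_iff.2 (hsum.congr fun H => ?_)
  exact (boxRatio_preimage_finset E φ B.toFinite.toFinset H).symm.trans
    (by rw [B.toFinite.coe_toFinset])

end FiniteQuotient

end Boxes

section ResidueChar

variable {R : Type*} [CommRing R]

/-- The residue characteristic of `𝔭`, that is, the rational prime below `𝔭`. -/
noncomputable def residueChar (v : HeightOneSpectrum R) : ℕ :=
  Ideal.absNorm (v.asIdeal.under ℤ)

theorem intCast_mem_iff_residueChar_dvd (v : HeightOneSpectrum R) {z : ℤ} :
    (z : R) ∈ v.asIdeal ↔ (residueChar v : ℤ) ∣ z :=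
  Int.cast_mem_ideal_iff

theorem residueChar_mem (v : HeightOneSpectrum R) : (residueChar v : R) ∈ v.asIdeal :=
  mod_cast (intCast_mem_iff_residueChar_dvd v).2 dvd_rfl

theorem residueChar_prime [IsDomain R] [Algebra.IsIntegral ℤ R] (v : HeightOneSpectrum R) :
    (residueChar v).Prime :=
  have : NeZero v.asIdeal := ⟨v.ne_bot⟩
  Nat.absNorm_under_prime v.asIdeal

variable [IsDedekindDomain R] [Module.Free ℤ R]

/-- The density `(N𝔭 - 1)² / N𝔭^(d+2)` of the polynomials of degree `d` that are
`𝔭`-Eisenstein. -/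
noncomputable def eisensteinDensityAt (d : ℕ) (v : HeightOneSpectrum R) : ℝ :=
  ((Ideal.absNorm v.asIdeal : ℝ) - 1) ^ 2 / (Ideal.absNorm v.asIdeal : ℝ) ^ (d + 2)

theorem eisensteinDensityAt_nonneg (d : ℕ) (v : HeightOneSpectrum R) :
    0 ≤ eisensteinDensityAt d v :=
  div_nonneg (sq_nonneg _) (by positivity)

variable [Module.Finite ℤ R]

theorem absNorm_pos (v : HeightOneSpectrum R) : 0 < Ideal.absNorm v.asIdeal :=
  Nat.pos_of_ne_zero (Ideal.absNorm_eq_zero_iff.not.2 v.ne_bot)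

theorem residueChar_le_absNorm (v : HeightOneSpectrum R) :
    residueChar v ≤ Ideal.absNorm v.asIdeal :=
  Nat.le_of_dvd (absNorm_pos v) (Int.absNorm_under_dvd_absNorm v.asIdeal)

theorem pow_ncard_le_absNorm {I : Ideal R} (hI : I ≠ ⊥) {m : ℕ} {T : Set (HeightOneSpectrum R)}
    (hdvd : ∀ v ∈ T, v.asIdeal ∣ I) (hm : ∀ v ∈ T, m ≤ residueChar v) :
    m ^ T.ncard ≤ Ideal.absNorm I := by
  classical
  obtain ⟨T, rfl⟩ := ((Ideal.finite_factors hI).subset hdvd).exists_finset_coe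
  have hprod : ∏ v ∈ T, v.asIdeal ∣ I := by
    rw [← Finset.prod_image (g := HeightOneSpectrum.asIdeal) (f := fun J => J)
      fun v _ w _ => HeightOneSpectrum.ext]
    exact Finset.prod_primes_dvd I (Finset.forall_mem_image.2 fun v _ => v.prime)
      (Finset.forall_mem_image.2 hdvd)
  calc m ^ (T : Set (HeightOneSpectrum R)).ncard
      = m ^ T.card := by rw [Set.ncard_coe_finset]
    _ ≤ ∏ v ∈ T, Ideal.absNorm v.asIdeal :=
        T.pow_card_le_prod _ _ fun v hv => (hm v hv).trans (residueChar_le_absNorm v)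
    _ ≤ Ideal.absNorm I := by
        rw [← map_prod]
        exact Nat.le_of_dvd (Nat.pos_of_ne_zero (Ideal.absNorm_eq_zero_iff.not.2 hI))
          (map_dvd Ideal.absNorm hprod)

theorem encard_residueChar_fiber_le (p : ℕ) :
    (residueChar (R := R) ⁻¹' {p}).encard ≤ Module.finrank ℤ R := by
  obtain hempty | ⟨w, rfl⟩ := (residueChar (R := R) ⁻¹' {p}).eq_empty_or_nonempty
  · simp [hempty]
  have hp := residueChar_prime w
  set I : Ideal R := Ideal.span {(residueChar w : R)}
  have hnorm : Ideal.absNorm I = residueChar w ^ Module.finrank ℤ R :=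
    Ideal.absNorm_span_natCast _
  have hI : I ≠ ⊥ := Ideal.absNorm_eq_zero_iff.not.1 (hnorm ▸ pow_ne_zero _ hp.ne_zero)
  have hdvd : ∀ v ∈ residueChar ⁻¹' {residueChar w}, v.asIdeal ∣ I := fun v hv =>
    Ideal.dvd_span_singleton.2 (Set.mem_singleton_iff.1 hv ▸ residueChar_mem v)
  refine Set.encard_le_coe_iff_finite_ncard_le.2 ⟨(Ideal.finite_factors hI).subset hdvd, ?_⟩
  rw [← Nat.pow_le_pow_iff_right hp.one_lt, ← hnorm]
  exact pow_ncard_le_absNorm hI hdvd fun v hv => hv.ge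

theorem finite_residueChar_le (n : ℕ) : {v : HeightOneSpectrum R | residueChar v ≤ n}.Finite :=
  (Set.finite_Iic n).preimage' fun p _ =>
    (Set.encard_le_coe_iff_finite_ncard_le.1 (encard_residueChar_fiber_le p)).1

variable (R) in
theorem summable_one_div_residueChar_sq :
    Summable fun v : HeightOneSpectrum R => 1 / (residueChar v : ℝ) ^ 2 := by
  classical
  have hsum : Summable fun n : ℕ => 1 / (n : ℝ) ^ 2 :=
    Real.summable_one_div_nat_pow.2 one_lt_two
  refine summable_of_sum_le (c := Module.finrank ℤ R * ∑' n : ℕ, 1 / (n : ℝ) ^ 2)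
    (fun v => by positivity) fun S => ?_
  have hfiber (p : ℕ) : (S.filter fun v => residueChar v = p).card ≤ Module.finrank ℤ R := by
    rw [← Nat.cast_le (α := ℕ∞), ← Set.encard_coe_eq_coe_finsetCard]
    refine (Set.encard_le_encard fun v hv => ?_).trans (encard_residueChar_fiber_le p)
    exact (Finset.mem_filter.1 hv).2
  calc ∑ v ∈ S, 1 / (residueChar v : ℝ) ^ 2
      = ∑ p ∈ S.image residueChar,
          (S.filter fun v => residueChar v = p).card • (1 / (p : ℝ) ^ 2) :=
        Finset.sum_comp (fun n : ℕ => 1 / (n : ℝ) ^ 2) residueChar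
    _ ≤ ∑ p ∈ S.image residueChar, Module.finrank ℤ R * (1 / (p : ℝ) ^ 2) := by
        gcongr with p
        rw [nsmul_eq_mul]
        gcongr
        exact hfiber p
    _ ≤ Module.finrank ℤ R * ∑' n : ℕ, 1 / (n : ℝ) ^ 2 := by
        rw [← Finset.mul_sum]
        gcongr
        exact hsum.sum_le_tsum _ fun _ _ => by positivity

theorem eisensteinDensityAt_le {d : ℕ} (hd : 2 ≤ d) (v : HeightOneSpectrum R) :
    eisensteinDensityAt d v ≤ 1 / (residueChar v : ℝ) ^ 2 := by
  have hN : (1 : ℝ) ≤ Ideal.absNorm v.asIdeal := mod_cast absNorm_pos v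
  have hp : (0 : ℝ) < residueChar v := mod_cast (residueChar_prime v).pos
  have hpN : (residueChar v : ℝ) ≤ Ideal.absNorm v.asIdeal := mod_cast residueChar_le_absNorm v
  unfold eisensteinDensityAt
  set N : ℝ := (Ideal.absNorm v.asIdeal : ℝ)
  calc (N - 1) ^ 2 / N ^ (d + 2) ≤ N ^ 2 / N ^ (d + 2) := by
        gcongr
        linarith
    _ = 1 / N ^ d := by
        rw [pow_add]
        field_simp
    _ ≤ 1 / N ^ 2 := by gcongr
    _ ≤ 1 / (residueChar v : ℝ) ^ 2 := by gcongr

theorem multipliable_one_sub_eisensteinDensityAt {d : ℕ} (hd : 2 ≤ d) :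
    Multipliable fun v : HeightOneSpectrum R => 1 - eisensteinDensityAt d v := by
  simp only [sub_eq_add_neg (1 : ℝ)]
  refine multipliable_one_add_of_summable ?_
  simp only [norm_neg]
  refine (summable_one_div_residueChar_sq R).of_nonneg_of_le (fun v => norm_nonneg _) fun v => ?_
  rw [Real.norm_of_nonneg (eisensteinDensityAt_nonneg d v)]
  exact eisensteinDensityAt_le hd v

end ResidueChar

section LocalConditions

variable {K : Type*} [Field K] [NumberField K] (E : IntegralBasis K)

theorem hasDensityWrt_forall_mk_mem {n : ℕ} {ι : Type*} [Fintype ι] {I : ι → Ideal (𝓞 K)}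
    (hI : ∀ i, I i ≠ ⊥) (hcop : Pairwise (Function.onFun IsCoprime I))
    (B : ∀ i, Set (Fin n → 𝓞 K ⧸ I i)) :
    HasDensityWrt E {a | ∀ i, Ideal.Quotient.mk (I i) ∘ a ∈ B i}
      (∏ i, ((B i).ncard / Nat.card (Fin n → 𝓞 K ⧸ I i) : ℝ)) := by
  have := fun i => Ideal.finiteQuotientOfFreeOfNeBot (I i) (hI i)
  let φ : (Fin n → 𝓞 K) →+ (∀ i, Fin n → 𝓞 K ⧸ I i) :=
    AddMonoidHom.pi fun i => (Ideal.Quotient.mk (I i)).toAddMonoidHom.compLeft (Fin n)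
  have hφ : Function.Surjective φ := by
    intro b
    choose a ha using fun j => Ideal.pi_quotient_surjective hcop fun i => b i j
    exact ⟨a, funext fun i => funext fun j => ha j i⟩
  have hpreimage : {a | ∀ i, Ideal.Quotient.mk (I i) ∘ a ∈ B i} = φ ⁻¹' Set.univ.pi B := by
    ext a
    exact Set.mem_univ_pi.symm
  rw [hpreimage, Finset.prod_div_distrib, ← Nat.cast_prod, ← Nat.cast_prod, ← ncard_univ_pi,
    ← Nat.card_pi]
  exact hasDensityWrt_preimage E hφ _

/-- The coefficient tuples `(b₀, …, b_d)` over `R` with `b_d ∉ I`, `b₀ ≠ 0` and `bᵢ ∈ I` for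
`i < d`. For `R = 𝔬 / 𝔭²` and `I = 𝔭 / 𝔭²` they are the reductions of the `𝔭`-Eisenstein
polynomials. -/
def eisensteinTuples {R : Type*} [CommRing R] (I : Ideal R) (d : ℕ) : Set (Fin (d + 1) → R) :=
  {b | b (Fin.last d) ∉ I ∧ b 0 ≠ 0 ∧ ∀ i : Fin d, b i.castSucc ∈ I}

theorem ncard_eisensteinTuples {R : Type*} [CommRing R] [Finite R] (I : Ideal R) (d : ℕ) :
    (eisensteinTuples I (d + 1)).ncard =
      (Nat.card I - 1) * Nat.card I ^ d * (Nat.card R - Nat.card I) := by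
  have hpi : eisensteinTuples I (d + 1) = Set.univ.pi
      (Fin.snoc (α := fun _ => Set R)
        (Fin.cons (α := fun _ => Set R) (I \ {0}) fun _ : Fin d => I) (Iᶜ : Set R)) := by
    ext b
    rw [Set.mem_univ_pi, Fin.forall_fin_succ', Fin.snoc_last]
    simp only [Fin.snoc_castSucc, eisensteinTuples, Set.mem_ofPred_eq]
    rw [Fin.forall_fin_succ, Fin.forall_fin_succ]
    simp only [Fin.cons_zero, Fin.cons_succ, Fin.castSucc_zero, Set.mem_compl_iff, Set.mem_sdiff,
      Set.mem_singleton_iff, SetLike.mem_coe]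
    tauto
  have hzero : ((I : Set R) \ {0}).ncard = Nat.card I - 1 :=
    Set.ncard_sdiff_singleton_of_mem I.zero_mem
  have hcompl : (Iᶜ : Set R).ncard = Nat.card R - Nat.card I := Set.ncard_compl _
  rw [hpi, ncard_univ_pi, Fin.prod_univ_castSucc]
  simp only [Fin.snoc_last, Fin.snoc_castSucc, Fin.prod_univ_succ, Fin.cons_zero, Fin.cons_succ,
    hzero, hcompl, Finset.prod_const, Finset.card_fin]
  rfl

variable (v : HeightOneSpectrum (𝓞 K))

theorem mk_comp_mem_eisensteinTuples {d : ℕ} {a : Fin (d + 1) → 𝓞 K} :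
    Ideal.Quotient.mk (v.asIdeal ^ 2) ∘ a ∈
      eisensteinTuples (v.asIdeal.map (Ideal.Quotient.mk (v.asIdeal ^ 2))) d ↔
        IsEisensteinAt v.asIdeal a := by
  simp only [eisensteinTuples, IsEisensteinAt, Set.mem_ofPred_eq, Function.comp_apply, ne_eq,
    Ideal.mem_quotient_iff_mem (Ideal.pow_le_self two_ne_zero), Ideal.Quotient.eq_zero_iff_mem]

theorem card_quotient_sq :
    Nat.card (𝓞 K ⧸ v.asIdeal ^ 2) = Ideal.absNorm v.asIdeal ^ 2 :=
  map_pow Ideal.absNorm v.asIdeal 2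

theorem card_map_mk_sq :
    Nat.card (v.asIdeal.map (Ideal.Quotient.mk (v.asIdeal ^ 2))) = Ideal.absNorm v.asIdeal := by
  have hlagrange := Submodule.card_eq_card_quotient_mul_card
    (v.asIdeal.map (Ideal.Quotient.mk (v.asIdeal ^ 2)))
  have hquot : Nat.card ((𝓞 K ⧸ v.asIdeal ^ 2) ⧸
      v.asIdeal.map (Ideal.Quotient.mk (v.asIdeal ^ 2))) = Ideal.absNorm v.asIdeal :=
    Nat.card_congr (DoubleQuot.quotQuotEquivQuotOfLE
      (Ideal.pow_le_self (I := v.asIdeal) two_ne_zero)).toEquiv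
  rw [card_quotient_sq, hquot, sq] at hlagrange
  exact (Nat.eq_of_mul_eq_mul_left (absNorm_pos v) (by linarith)).symm

theorem ncard_eisensteinTuples_div_card {d : ℕ} (hd : 1 ≤ d) :
    ((eisensteinTuples (v.asIdeal.map (Ideal.Quotient.mk (v.asIdeal ^ 2))) d).ncard : ℝ) /
      Nat.card (Fin (d + 1) → 𝓞 K ⧸ v.asIdeal ^ 2) = eisensteinDensityAt d v := by
  have := Ideal.finiteQuotientOfFreeOfNeBot _ (pow_ne_zero 2 v.ne_bot)
  obtain ⟨e, rfl⟩ := Nat.exists_eq_add_of_le' hd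
  have hpos := absNorm_pos v
  rw [ncard_eisensteinTuples, card_map_mk_sq, Nat.card_fun, card_quotient_sq, Nat.card_fin,
    eisensteinDensityAt]
  push_cast [Nat.le_self_pow two_ne_zero (Ideal.absNorm v.asIdeal), Nat.cast_sub hpos]
  field_simp
  ring

theorem hasDensityWrt_exists_isEisensteinAt {d : ℕ} (hd : 1 ≤ d)
    (S : Finset (HeightOneSpectrum (𝓞 K))) :
    HasDensityWrt E {a : Fin (d + 1) → 𝓞 K | ∃ v ∈ S, IsEisensteinAt v.asIdeal a}
      (1 - ∏ v ∈ S, (1 - eisensteinDensityAt d v)) := by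
  have hcop : Pairwise (Function.onFun IsCoprime fun v : S => v.1.asIdeal ^ 2) := fun v w hvw =>
    HeightOneSpectrum.isCoprime_pow_of_ne _ _ (Subtype.coe_injective.ne hvw) _ _
  have hdens := (hasDensityWrt_forall_mk_mem E (fun v : S => pow_ne_zero 2 v.1.ne_bot) hcop
    fun v => (eisensteinTuples (v.1.asIdeal.map (Ideal.Quotient.mk (v.1.asIdeal ^ 2))) d)ᶜ).compl
  have hlocal (v : HeightOneSpectrum (𝓞 K)) :
      ((eisensteinTuples (v.asIdeal.map (Ideal.Quotient.mk (v.asIdeal ^ 2))) d)ᶜ.ncard : ℝ) /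
        Nat.card (Fin (d + 1) → 𝓞 K ⧸ v.asIdeal ^ 2) = 1 - eisensteinDensityAt d v := by
    have := Ideal.finiteQuotientOfFreeOfNeBot _ (pow_ne_zero 2 v.ne_bot)
    rw [← ncard_eisensteinTuples_div_card v hd, eq_sub_iff_add_eq', ← add_div, ← Nat.cast_add,
      Set.ncard_add_ncard_compl]
    exact div_self (Nat.cast_ne_zero.2 Nat.card_pos.ne')
  simp only [hlocal, Set.mem_compl_iff, mk_comp_mem_eisensteinTuples] at hdens
  rw [Finset.prod_coe_sort S fun v => 1 - eisensteinDensityAt d v] at hdens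
  convert hdens using 1
  ext a
  simp

end LocalConditions

section PrimesInBoxes

theorem ncard_le_of_modEq {ι : Type*} [Fintype ι] {q : ℕ} (hq : 0 < q) {H : ℕ} (j : ι)
    {T : Set (ι → ℤ)} (hbox : T ⊆ Set.univ.pi fun _ => Set.Ico (-(H : ℤ)) H)
    (hmod : ∀ x ∈ T, ∀ y ∈ T, (∀ i ≠ j, x i = y i) → x j ≡ y j [ZMOD q]) :
    T.ncard ≤ (2 * H) ^ (Fintype.card ι - 1) * (2 * H / q + 1) := by
  classical
  have hq' : (0 : ℤ) < q := mod_cast hq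
  let F : Set (({i // i ≠ j} → ℤ) × ℤ) :=
    (Set.univ.pi fun _ => Set.Ico (-(H : ℤ)) H) ×ˢ Set.Ico 0 ((2 * H / q + 1 : ℕ) : ℤ)
  have hF : F.ncard = (2 * H) ^ (Fintype.card ι - 1) * (2 * H / q + 1) := by
    have hquot : (Set.Ico 0 ((2 * H / q + 1 : ℕ) : ℤ)).ncard = 2 * H / q + 1 := by
      rw [Set.ncard_eq_toFinset_card', Set.toFinset_Ico, Int.card_Ico, sub_zero, Int.toNat_natCast]
    rw [Set.ncard_prod, ncard_univ_pi, hquot]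
    simp [ncard_Ico_neg]
  rw [← hF]
  refine Set.ncard_le_ncard_of_injOn (fun x => (fun i : {i // i ≠ j} => x i, (x j + H) / (q : ℤ)))
    (fun x hx => ?_) (fun x hx y hy hxy => ?_)
    ((Set.Finite.pi fun _ => Set.finite_Ico _ _).prod (Set.finite_Ico _ _))
  · have hxj := hbox hx j trivial
    rw [Set.mem_Ico] at hxj
    refine ⟨fun i _ => hbox hx i trivial, Int.ediv_nonneg (by lia) hq'.le, ?_⟩
    have hle : (x j + H) / (q : ℤ) ≤ 2 * H / q := Int.ediv_le_ediv hq' (by lia)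
    push_cast
    lia
  · simp only [Prod.mk.injEq, funext_iff, Subtype.forall] at hxy
    obtain ⟨hoff, hdiv⟩ := hxy
    have hmodj : (x j + H) % (q : ℤ) = (y j + H) % q := (hmod x hx y hy hoff).add_right _
    have hxyj : x j = y j := by
      have hx' := Int.emod_add_mul_ediv (x j + H) q
      have hy' := Int.emod_add_mul_ediv (y j + H) q
      rw [hmodj, hdiv] at hx'
      lia
    funext i
    obtain rfl | hi := eq_or_ne i j
    · exact hxyj
    · exact hoff i hi

section Basis

variable {ι R : Type*} [Finite ι] [CommRing R] (E : Module.Basis ι ℤ R)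

theorem exists_basis_notMem {I : Ideal R} (hI : I ≠ ⊤) : ∃ j, E j ∉ I := by
  have := Fintype.ofFinite ι
  by_contra! hE
  refine hI ((Ideal.eq_top_iff_one I).2 ?_)
  rw [← E.sum_repr 1]
  exact I.sum_mem fun i _ => Submodule.smul_of_tower_mem I _ (hE i)

variable {E} in
theorem repr_modEq_residueChar {v : HeightOneSpectrum R} {j : ι} (hj : E j ∉ v.asIdeal) {x y : R}
    (hx : x ∈ v.asIdeal) (hy : y ∈ v.asIdeal) (hxy : ∀ i ≠ j, E.repr x i = E.repr y i) :
    E.repr x j ≡ E.repr y j [ZMOD residueChar v] := by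
  have := Fintype.ofFinite ι
  have hsub : x - y = (E.repr x j - E.repr y j : ℤ) * E j := by
    rw [← E.sum_repr (x - y), Fintype.sum_eq_single j fun i hi => by simp [hxy i hi]]
    simp
  have hmem := v.asIdeal.sub_mem hx hy
  rw [hsub] at hmem
  exact (Int.modEq_iff_dvd.2 ((intCast_mem_iff_residueChar_dvd v).1
    ((v.isPrime.mem_or_mem hmem).resolve_right hj))).symm

end Basis

variable {K : Type*} [Field K] [NumberField K] (E : IntegralBasis K)

theorem ncard_inter_box_le (v : HeightOneSpectrum (𝓞 K)) (H : ℕ) :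
    ((v.asIdeal : Set (𝓞 K)) ∩ box E H).ncard ≤
      (2 * H) ^ (Module.finrank ℚ K - 1) * (2 * H / residueChar v + 1) := by
  obtain ⟨j, hj⟩ := exists_basis_notMem E v.isPrime.ne_top
  have hcount := ncard_le_of_modEq (residueChar_prime v).pos j
    (T := E.equivFun '' (v.asIdeal ∩ box E H)) (H := H)
    (Set.image_subset_iff.2 fun x hx i _ => hx.2 i)
    (Set.forall_mem_image.2 fun x hx => Set.forall_mem_image.2 fun y hy =>
      repr_modEq_residueChar hj hx.1 hy.1)
  rwa [Set.ncard_image_of_injective _ E.equivFun.injective, Fintype.card_fin] at hcount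

theorem ncard_inter_box_le_of_lt {v : HeightOneSpectrum (𝓞 K)} {H : ℕ}
    (hv : 2 * H < residueChar v) :
    ((v.asIdeal : Set (𝓞 K)) ∩ box E H).ncard ≤ (2 * H) ^ (Module.finrank ℚ K - 1) := by
  simpa [Nat.div_eq_of_lt hv] using ncard_inter_box_le E v H

theorem ncard_inter_box_le_div {v : HeightOneSpectrum (𝓞 K)} {H : ℕ}
    (hv : residueChar v ≤ 2 * H) : (((v.asIdeal : Set (𝓞 K)) ∩ box E H).ncard : ℝ) ≤
      2 * (2 * (H : ℝ)) ^ Module.finrank ℚ K / residueChar v := by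
  have hfloor : ((2 * H / residueChar v : ℕ) : ℝ) ≤ 2 * H / residueChar v := by
    exact_mod_cast Nat.cast_div_le (α := ℝ) (m := 2 * H) (n := residueChar v)
  have hone : (1 : ℝ) ≤ 2 * H / residueChar v := by
    rw [one_le_div (mod_cast (residueChar_prime v).pos)]
    exact_mod_cast hv
  calc (((v.asIdeal : Set (𝓞 K)) ∩ box E H).ncard : ℝ)
      ≤ (2 * (H : ℝ)) ^ (Module.finrank ℚ K - 1) * ((2 * H / residueChar v : ℕ) + 1) := by
        exact_mod_cast ncard_inter_box_le E v H
    _ ≤ (2 * (H : ℝ)) ^ (Module.finrank ℚ K - 1) * (2 * (2 * H / residueChar v)) := by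
        gcongr
        linarith
    _ = 2 * (2 * (H : ℝ)) ^ Module.finrank ℚ K / residueChar v := by
        rw [← pow_sub_one_mul Module.finrank_pos.ne' (2 * (H : ℝ))]
        ring

theorem eventually_natAbs_norm_lt :
    ∀ᶠ H : ℕ in atTop, ∀ x ∈ box E H,
      (Algebra.norm ℤ x).natAbs < (2 * H) ^ (Module.finrank ℚ K + 1) := by
  obtain ⟨C, hC⟩ := Int.eq_ofNat_of_zero_le (ClassGroup.normBound_pos AbsoluteValue.abs E).le
  filter_upwards [eventually_gt_atTop C] with H hH x hx
  have hnorm := ClassGroup.norm_le AbsoluteValue.abs E x (y := H) fun j => by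
    have hxj := hx j
    rw [Set.mem_Ico] at hxj
    rw [AbsoluteValue.abs_apply, abs_le]
    lia
  rw [hC, Fintype.card_fin, AbsoluteValue.abs_apply] at hnorm
  calc (Algebra.norm ℤ x).natAbs ≤ C * H ^ Module.finrank ℚ K := by zify; exact hnorm
    _ < (2 * H) * (2 * H) ^ Module.finrank ℚ K := by
        have hHpos : 0 < H := by lia
        refine Nat.mul_lt_mul_of_lt_of_le (by lia) ?_ (by positivity)
        gcongr
        lia
    _ = (2 * H) ^ (Module.finrank ℚ K + 1) := (pow_succ' _ _).symm

theorem eventually_ncard_primes_le :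
    ∀ᶠ H : ℕ in atTop, ∀ x ∈ box E H, x ≠ 0 →
      {v : HeightOneSpectrum (𝓞 K) | x ∈ v.asIdeal ∧ 2 * H < residueChar v}.ncard ≤
        Module.finrank ℚ K := by
  filter_upwards [eventually_natAbs_norm_lt E, eventually_gt_atTop 0] with H hnorm hH x hx hx0
  have hpow := pow_ncard_le_absNorm (I := Ideal.span {x}) (m := 2 * H)
    (T := {v | x ∈ v.asIdeal ∧ 2 * H < residueChar v}) (by simpa using hx0)
    (fun v hv => Ideal.dvd_span_singleton.2 hv.1) fun v hv => hv.2.le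
  rw [Ideal.absNorm_span_singleton] at hpow
  exact Nat.lt_succ_iff.1 ((Nat.pow_lt_pow_iff_right (by lia)).1 (hpow.trans_lt (hnorm x hx)))

end PrimesInBoxes

section Tail

/-- The pairs `(x, y)` with `x ≠ 0` such that `x` and `y` lie in a common prime of `Q`. The constant
and the linear coefficient of a `𝔭`-Eisenstein polynomial with `𝔭 ∈ Q` form such a pair. -/
def pairsWithCommonPrime {R : Type*} [CommRing R] (Q : Set (HeightOneSpectrum R)) : Set (R × R) :=
  {x | x.1 ≠ 0 ∧ ∃ v ∈ Q, x.1 ∈ v.asIdeal ∧ x.2 ∈ v.asIdeal}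

theorem ncard_biUnion_le_mul {α β : Type*} {s : Set α} (hs : s.Finite) {t : α → Set β} {m : ℕ}
    (ht : ∀ a ∈ s, (t a).ncard ≤ m) : (⋃ a ∈ s, t a).ncard ≤ s.ncard * m := by
  obtain ⟨s, rfl⟩ := hs.exists_finset_coe
  rw [Set.ncard_coe_finset, ← smul_eq_mul]
  exact (s.set_ncard_biUnion_le t).trans (s.sum_le_card_nsmul _ _ ht)

theorem sum_le_tsum_subtype {ι : Type*} {f : ι → ℝ} (hf : Summable f) (hf₀ : ∀ i, 0 ≤ f i)
    {P : Finset ι} {Q : Set ι} (hPQ : ↑P ⊆ Q) : ∑ i ∈ P, f i ≤ ∑' i : Q, f i := by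
  rw [tsum_subtype Q f, ← Finset.sum_congr rfl fun i hi => Set.indicator_of_mem (hPQ hi) f]
  exact (hf.indicator Q).sum_le_tsum P fun i _ => Set.indicator_nonneg (fun i _ => hf₀ i) i

variable {K : Type*} [Field K] [NumberField K] (E : IntegralBasis K)

theorem ncard_pairsWithCommonPrime_le_sum {H : ℕ} (Q : Finset (HeightOneSpectrum (𝓞 K)))
    (hQ : ∀ v ∈ Q, residueChar v ≤ 2 * H) :
    ((pairsWithCommonPrime ↑Q ∩ box E H ×ˢ box E H).ncard : ℝ) ≤
      4 * (∑ v ∈ Q, 1 / (residueChar v : ℝ) ^ 2) * (2 * (H : ℝ)) ^ (2 * Module.finrank ℚ K) := by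
  have hcover : pairsWithCommonPrime ↑Q ∩ box E H ×ˢ box E H ⊆
      ⋃ v ∈ Q, ((v.asIdeal : Set (𝓞 K)) ∩ box E H) ×ˢ ((v.asIdeal : Set (𝓞 K)) ∩ box E H) := by
    rintro x ⟨⟨-, v, hvQ, hx₁, hx₂⟩, hbox₁, hbox₂⟩
    exact Set.mem_biUnion hvQ ⟨⟨hx₁, hbox₁⟩, ⟨hx₂, hbox₂⟩⟩
  have hcount : (pairsWithCommonPrime ↑Q ∩ box E H ×ˢ box E H).ncard ≤
      ∑ v ∈ Q, ((v.asIdeal : Set (𝓞 K)) ∩ box E H).ncard ^ 2 := by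
    simp only [sq, ← Set.ncard_prod]
    refine (Set.ncard_le_ncard hcover ?_).trans (Q.set_ncard_biUnion_le _)
    exact Q.finite_toSet.biUnion fun v _ =>
      ((box_finite E H).inter_of_right _).prod ((box_finite E H).inter_of_right _)
  calc ((pairsWithCommonPrime ↑Q ∩ box E H ×ˢ box E H).ncard : ℝ)
      ≤ ∑ v ∈ Q, (((v.asIdeal : Set (𝓞 K)) ∩ box E H).ncard : ℝ) ^ 2 := by exact_mod_cast hcount
    _ ≤ ∑ v ∈ Q, (2 * (2 * (H : ℝ)) ^ Module.finrank ℚ K / residueChar v) ^ 2 := by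
        gcongr with v hv
        exact ncard_inter_box_le_div E (hQ v hv)
    _ = 4 * (∑ v ∈ Q, 1 / (residueChar v : ℝ) ^ 2) *
          (2 * (H : ℝ)) ^ (2 * Module.finrank ℚ K) := by
        rw [Finset.mul_sum, Finset.sum_mul]
        refine Finset.sum_congr rfl fun v _ => ?_
        rw [mul_comm 2 (Module.finrank ℚ K), pow_mul]
        ring

theorem eventually_ncard_pairsWithCommonPrime_le :
    ∀ᶠ H : ℕ in atTop, (pairsWithCommonPrime {v | 2 * H < residueChar v} ∩
        box E H ×ˢ box E H).ncard ≤
      (2 * H) ^ Module.finrank ℚ K *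
        (Module.finrank ℚ K * (2 * H) ^ (Module.finrank ℚ K - 1)) := by
  filter_upwards [eventually_ncard_primes_le E] with H hprimes
  let P (x : 𝓞 K) : Set (HeightOneSpectrum (𝓞 K)) :=
    {v | x ∈ v.asIdeal ∧ 2 * H < residueChar v}
  have hPfin {x : 𝓞 K} (hx : x ≠ 0) : (P x).Finite :=
    (Ideal.finite_factors (I := Ideal.span {x}) (by simpa using hx)).subset fun v hv =>
      Ideal.dvd_span_singleton.2 hv.1
  let X := box E H \ {0}
  have hX : X.Finite := (box_finite E H).sdiff
  have hXcard : X.ncard ≤ (2 * H) ^ Module.finrank ℚ K :=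
    ncard_box E H ▸ Set.ncard_le_ncard Set.sdiff_subset (box_finite E H)
  let Y (v : HeightOneSpectrum (𝓞 K)) : Set (𝓞 K) := v.asIdeal ∩ box E H
  have hY (v : HeightOneSpectrum (𝓞 K)) : (Y v).Finite := (box_finite E H).inter_of_right _
  have hcover : pairsWithCommonPrime {v | 2 * H < residueChar v} ∩ box E H ×ˢ box E H ⊆
      ⋃ x ∈ X, ⋃ v ∈ P x, {x} ×ˢ Y v := by
    rintro x ⟨⟨hx0, v, hv, hx₁, hx₂⟩, hbox₁, hbox₂⟩
    exact Set.mem_biUnion (show x.1 ∈ X from ⟨hbox₁, hx0⟩)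
      (Set.mem_biUnion (show v ∈ P x.1 from ⟨hx₁, hv⟩) ⟨rfl, hx₂, hbox₂⟩)
  have hfiber : ∀ x ∈ X, (⋃ v ∈ P x, {x} ×ˢ Y v).ncard ≤
      Module.finrank ℚ K * (2 * H) ^ (Module.finrank ℚ K - 1) := fun x hx => by
    refine (ncard_biUnion_le_mul (hPfin hx.2) fun v hv => ?_).trans
      (Nat.mul_le_mul_right _ (hprimes x hx.1 hx.2))
    rw [Set.ncard_prod, Set.ncard_singleton, one_mul]
    exact ncard_inter_box_le_of_lt E hv.2
  refine (Set.ncard_le_ncard hcover ?_).trans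
    ((ncard_biUnion_le_mul hX hfiber).trans (Nat.mul_le_mul_right _ hXcard))
  exact hX.biUnion fun x hx => (hPfin hx.2).biUnion fun v _ => (Set.finite_singleton x).prod (hY v)

theorem eventually_ncard_pairsWithCommonPrime_div_le :
    ∀ᶠ H : ℕ in atTop, ∀ Q : Set (HeightOneSpectrum (𝓞 K)),
      ((pairsWithCommonPrime Q ∩ box E H ×ˢ box E H).ncard : ℝ) /
          (2 * (H : ℝ)) ^ (2 * Module.finrank ℚ K) ≤
        4 * ∑' v : Q, 1 / (residueChar v.1 : ℝ) ^ 2 + Module.finrank ℚ K / (2 * (H : ℝ)) := by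
  filter_upwards [eventually_ncard_pairsWithCommonPrime_le E, eventually_gt_atTop 0]
    with H hlarge hH Q
  obtain ⟨P, hP⟩ := ((finite_residueChar_le (R := 𝓞 K) (2 * H)).inter_of_right Q).exists_finset_coe
  have hbox : (box E H ×ˢ box E H).Finite := (box_finite E H).prod (box_finite E H)
  have hsplit : (pairsWithCommonPrime Q ∩ box E H ×ˢ box E H).ncard ≤
      (pairsWithCommonPrime ↑P ∩ box E H ×ˢ box E H).ncard +
        (pairsWithCommonPrime {v | 2 * H < residueChar v} ∩ box E H ×ˢ box E H).ncard := by
    refine (Set.ncard_le_ncard ?_ ((hbox.inter_of_right _).union (hbox.inter_of_right _))).trans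
      (Set.ncard_union_le _ _)
    rintro x ⟨⟨hx0, v, hv, hx⟩, hxbox⟩
    obtain hle | hlt := le_or_gt (residueChar v) (2 * H)
    · exact Or.inl ⟨⟨hx0, v, hP ▸ ⟨hv, hle⟩, hx⟩, hxbox⟩
    · exact Or.inr ⟨⟨hx0, v, hlt, hx⟩, hxbox⟩
  have hsmall := ncard_pairsWithCommonPrime_le_sum E P fun v hv => (hP.subset hv).2
  have hsum : ∑ v ∈ P, 1 / (residueChar v : ℝ) ^ 2 ≤
      ∑' v : Q, 1 / (residueChar v.1 : ℝ) ^ 2 :=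
    sum_le_tsum_subtype (summable_one_div_residueChar_sq (𝓞 K)) (fun v => by positivity)
      (hP.subset.trans Set.inter_subset_left)
  have hpow : (2 * (H : ℝ)) ^ Module.finrank ℚ K *
      (Module.finrank ℚ K * (2 * (H : ℝ)) ^ (Module.finrank ℚ K - 1)) =
        Module.finrank ℚ K / (2 * (H : ℝ)) * (2 * (H : ℝ)) ^ (2 * Module.finrank ℚ K) := by
    rw [two_mul (Module.finrank ℚ K), pow_add,
      ← pow_sub_one_mul Module.finrank_pos.ne' (2 * (H : ℝ))]
    field_simp
  rw [div_le_iff₀ (by positivity), add_mul, ← hpow]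
  calc ((pairsWithCommonPrime Q ∩ box E H ×ˢ box E H).ncard : ℝ)
      ≤ (pairsWithCommonPrime ↑P ∩ box E H ×ˢ box E H).ncard +
        (pairsWithCommonPrime {v | 2 * H < residueChar v} ∩ box E H ×ˢ box E H).ncard := by
        exact_mod_cast hsplit
    _ ≤ _ := by
        refine add_le_add (hsmall.trans ?_) (mod_cast hlarge)
        gcongr

theorem boxRatio_pairs_le {n H : ℕ} (hH : H ≠ 0) (P : Set (𝓞 K × 𝓞 K)) :
    boxRatio E {a : Fin (n + 2) → 𝓞 K | (a 0, a 1) ∈ P} H ≤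
      ((P ∩ box E H ×ˢ box E H).ncard : ℝ) / (2 * (H : ℝ)) ^ (2 * Module.finrank ℚ K) := by
  have hcount : ({a : Fin (n + 2) → 𝓞 K | (a 0, a 1) ∈ P} ∩ boxPow E (n + 2) H).ncard ≤
      (P ∩ box E H ×ˢ box E H).ncard * (boxPow E n H).ncard := by
    rw [← Set.ncard_prod]
    refine Set.ncard_le_ncard_of_injOn (fun a => ((a 0, a 1), fun i => a i.succ.succ))
      (fun a ha => ⟨⟨ha.1, ha.2 0, ha.2 1⟩, fun i => ha.2 _⟩) (fun a _ b _ hab => ?_)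
      ((((box_finite E H).prod (box_finite E H)).inter_of_right _).prod (boxPow_finite E n H))
    simp only [Prod.mk.injEq, funext_iff] at hab
    exact funext (Fin.cases hab.1.1 (Fin.cases hab.1.2 hab.2))
  rw [ncard_boxPow] at hcount
  calc boxRatio E {a : Fin (n + 2) → 𝓞 K | (a 0, a 1) ∈ P} H
      ≤ ((P ∩ box E H ×ˢ box E H).ncard * (2 * (H : ℝ)) ^ (n * Module.finrank ℚ K)) /
          (2 * (H : ℝ)) ^ ((n + 2) * Module.finrank ℚ K) := by
        unfold boxRatio
        gcongr
        exact_mod_cast hcount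
    _ = (P ∩ box E H ×ˢ box E H).ncard / (2 * (H : ℝ)) ^ (2 * Module.finrank ℚ K) := by
        rw [add_mul, pow_add, mul_comm ((2 * (H : ℝ)) ^ (n * _))]
        exact mul_div_mul_right _ _ (by positivity)

end Tail

section EisensteinPolynomials

variable {K : Type*} [Field K] [NumberField K]

theorem eisensteinSet_eq (d : ℕ) : eisensteinSet K d =
    {a | ∃ v : HeightOneSpectrum (𝓞 K), IsEisensteinAt v.asIdeal a} := by
  ext a
  exact ⟨fun ⟨𝔭, hprime, hbot, ha⟩ => ⟨⟨𝔭, hprime, hbot⟩, ha⟩,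
    fun ⟨v, hv⟩ => ⟨v.asIdeal, v.isPrime, v.ne_bot, hv⟩⟩

theorem eisensteinSet_sdiff_subset (e : ℕ) (S : Set (HeightOneSpectrum (𝓞 K))) :
    eisensteinSet K (e + 2) \ {a | ∃ v ∈ S, IsEisensteinAt v.asIdeal a} ⊆
      {a | (a 0, a 1) ∈ pairsWithCommonPrime Sᶜ} := by
  rw [eisensteinSet_eq]
  rintro a ⟨⟨v, hv⟩, haS⟩
  refine ⟨fun h0 : a 0 = 0 => hv.2.1 ?_, v, fun hvS => haS ⟨v, hvS, hv⟩, hv.2.2 0, hv.2.2 1⟩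
  rw [h0]
  exact zero_mem _

theorem eventually_boxRatio_eisensteinSet_sdiff_le (E : IntegralBasis K) (e : ℕ)
    (S : Set (HeightOneSpectrum (𝓞 K))) :
    ∀ᶠ H : ℕ in atTop,
      boxRatio E (eisensteinSet K (e + 2) \ {a | ∃ v ∈ S, IsEisensteinAt v.asIdeal a}) H ≤
        4 * ∑' v : ↥Sᶜ, 1 / (residueChar v.1 : ℝ) ^ 2 +
          Module.finrank ℚ K / (2 * (H : ℝ)) := by
  filter_upwards [eventually_ncard_pairsWithCommonPrime_div_le E, eventually_ne_atTop 0]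
    with H hpairs hH
  calc boxRatio E (eisensteinSet K (e + 2) \ {a | ∃ v ∈ S, IsEisensteinAt v.asIdeal a}) H
      ≤ boxRatio E {a : Fin (e + 1 + 2) → 𝓞 K | (a 0, a 1) ∈ pairsWithCommonPrime Sᶜ} H :=
        boxRatio_mono E (eisensteinSet_sdiff_subset e S) H
    _ ≤ ((pairsWithCommonPrime Sᶜ ∩ box E H ×ˢ box E H).ncard : ℝ) /
          (2 * (H : ℝ)) ^ (2 * Module.finrank ℚ K) := boxRatio_pairs_le E hH _
    _ ≤ _ := hpairs Sᶜ

theorem hasDensity_eisensteinSet {d : ℕ} (hd : 2 ≤ d) :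
    HasDensity (eisensteinSet K d)
      (1 - ∏' v : HeightOneSpectrum (𝓞 K), (1 - eisensteinDensityAt d v)) := by
  intro E
  obtain ⟨e, rfl⟩ := Nat.exists_eq_add_of_le' hd
  have hprod := (multipliable_one_sub_eisensteinDensityAt (R := 𝓞 K) hd).hasProd
  have htail := (tendsto_tsum_compl_atTop_zero
    fun v : HeightOneSpectrum (𝓞 K) => 1 / (residueChar v : ℝ) ^ 2).const_mul 4
  rw [mul_zero] at htail
  have hvanish : Tendsto (fun H : ℕ => (Module.finrank ℚ K : ℝ) / (2 * (H : ℝ))) atTop (𝓝 0) :=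
    tendsto_const_nhds.div_atTop (tendsto_natCast_atTop_atTop.const_mul_atTop two_pos)
  have hsub (S : Finset (HeightOneSpectrum (𝓞 K))) :
      {a | ∃ v ∈ S, IsEisensteinAt v.asIdeal a} ⊆ eisensteinSet K (e + 2) := by
    rw [eisensteinSet_eq]
    exact fun a ⟨v, _, hv⟩ => ⟨v, hv⟩
  have hdiff (S : Finset (HeightOneSpectrum (𝓞 K))) :=
    eventually_boxRatio_eisensteinSet_sdiff_le E e (S : Set (HeightOneSpectrum (𝓞 K)))
  exact hasDensityWrt_of_tendsto hsub (hasDensityWrt_exists_isEisensteinAt E (by lia))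
    (hprod.const_sub 1) htail hvanish hdiff

end EisensteinPolynomials

end EisensteinDensity

theorem corollary4p2 (K : Type*) [Field K] [NumberField K] (d : ℕ) (hd : 2 ≤ d) :
    Multipliable (fun 𝔭 : IsDedekindDomain.HeightOneSpectrum (𝓞 K) =>
      1 - ((Ideal.absNorm 𝔭.asIdeal : ℝ) - 1) ^ 2 / (Ideal.absNorm 𝔭.asIdeal : ℝ) ^ (d + 2)) ∧
    EisensteinDensity.HasDensity (EisensteinDensity.eisensteinSet K d)
      (1 - ∏' 𝔭 : IsDedekindDomain.HeightOneSpectrum (𝓞 K),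
        (1 - ((Ideal.absNorm 𝔭.asIdeal : ℝ) - 1) ^ 2 /
          (Ideal.absNorm 𝔭.asIdeal : ℝ) ^ (d + 2))) :=
  ⟨EisensteinDensity.multipliable_one_sub_eisensteinDensityAt hd,
    EisensteinDensity.hasDensity_eisensteinSet hd⟩
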